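/- Let $V$ be an oriented 4-dimensional real inner product space (the cotangent space at a point of an oriented Riemannian 4-manifold), and let $\Lambda^2=\Lambda^2V$ be the 6-dimensional space of 2-forms with the inner product $\langle a\wedge b,c\wedge d\rangle=\langle a,c\rangle\langle b,d\rangle-\langle a,d\rangle\langle b,c\rangle$. Let $R$ be a curvature operator, i.e. a symmetric (self-adjoint) linear operator on $\Lambda^2$. Let $I$ be the identity of $\Lambda^2$, and let $K$ be the volume form $\mathrm{vol}$ with two indices raised, i.e. the operator on $\Lambda^2$ with $\langle K\alpha,\beta\rangle=\mathrm{vol}(\alpha\wedge\beta)$ for all $\alpha,\beta$. Let $S_2=\{v\in\Lambda^2: v=a\wedge b \text{ for some } a,b\in V,\ \|v\|=1\}$ be the Grassmannian of oriented 2-planes. The sectional curvature of $R$ is the function $f:S_2\to\mathbb R$, $f(v)=\langle v,Rv\rangle$; its critical values are the numbers $f(v)$ with $v$ a critical point of $f$ on $S_2$. $R$ is called sectionally positive (nonnegative) if $f>0$ ($f\ge 0$) on $S_2$. Put $p(x,y)=\det(R-xI-yK)$ and $q(x)=\mathrm{disc}_y\,p(x,y)$, the discriminant of $p$ as a polynomial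 in $y$. Then: 1. Every critical value of the sectional curvature of $R$ is a real root of $q$. 2. If all real roots of $q$ are positive (nonnegative), then $R$ is sectionally positive (nonnegative). 3. Suppose $\mathrm{disc}_x(q)\neq 0$, i.e. $q$ is not the zero polynomial and its discriminant (taken for its actual degree) is nonzero. Then the set of real roots of $q$ is exactly the set of critical values of the sectional curvature of $R$, and $R$ is sectionally positive (nonnegative) if and only if all real roots of $q$ are positive (nonnegative). -/

import Mathlib

open scoped ContDiff RealInnerProductSpace

noncomputable section

namespace Curv4

variable {V : Type*} [NormedAddCommGroup V] [InnerProductSpace ℝ V]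

/-- The wedge product `⋀² V × ⋀² V → ⋀⁴ V`, i.e. the product of the exterior algebra. -/
def wedge : ⋀[ℝ]^2 V →ₗ[ℝ] ⋀[ℝ]^2 V →ₗ[ℝ] ⋀[ℝ]^4 V :=
  LinearMap.mk₂ ℝ
    (fun α β => ⟨(α : ExteriorAlgebra ℝ V) * (β : ExteriorAlgebra ℝ V), by
      have h := SetLike.mul_mem_graded (A := fun i : ℕ => ⋀[ℝ]^i V) α.2 β.2
      exact h⟩)
    (fun a b c => Subtype.ext (by simp [add_mul]))
    (fun r a b => Subtype.ext (by simp))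
    (fun a b c => Subtype.ext (by simp [mul_add]))
    (fun r a b => Subtype.ext (by simp))

/-- The decomposable element `a ∧ b` of `⋀² V`. -/
def wedge₂ (a b : V) : ⋀[ℝ]^2 V := exteriorPower.ιMulti ℝ 2 ![a, b]

variable [FiniteDimensional ℝ V]

/-- The set of decomposable elements of `⋀² V` of norm one, i.e. the Grassmannian of oriented
two-planes of `V`, inside the unit sphere of `⋀² V`. -/
def unitDecomposable (V : Type*) [NormedAddCommGroup V] [InnerProductSpace ℝ V]
    [FiniteDimensional ℝ V] : Set (⋀[ℝ]^2 V) :=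
  {v | (∃ a b : V, v = wedge₂ a b) ∧ ‖v‖ = 1}

/-- The quadratic function `v ↦ ⟨v, R v⟩`; on unit decomposable elements it is the sectional
curvature of `R`. -/
def sec (R : ⋀[ℝ]^2 V →ₗ[ℝ] ⋀[ℝ]^2 V) (v : ⋀[ℝ]^2 V) : ℝ := ⟪v, R v⟫

/-- `v` is a critical point of the restriction of `sec R` to the Grassmannian of oriented
two-planes: the derivative of `sec R` vanishes along every smooth curve in the Grassmannian
through `v`. -/
def IsCriticalPoint (R : ⋀[ℝ]^2 V →ₗ[ℝ] ⋀[ℝ]^2 V) (v : ⋀[ℝ]^2 V) : Prop :=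
  v ∈ unitDecomposable V ∧
    ∀ γ : ℝ → ⋀[ℝ]^2 V, ContDiff ℝ ∞ γ → (∀ t, γ t ∈ unitDecomposable V) → γ 0 = v →
      HasDerivAt (fun t => sec R (γ t)) 0 0

/-- The set of critical values of the sectional curvature of `R`. -/
def criticalValues (R : ⋀[ℝ]^2 V →ₗ[ℝ] ⋀[ℝ]^2 V) : Set ℝ :=
  {c | ∃ v, IsCriticalPoint R v ∧ sec R v = c}

/-- All sectional curvatures of `R` are positive. -/
def SectionallyPositive (R : ⋀[ℝ]^2 V →ₗ[ℝ] ⋀[ℝ]^2 V) : Prop :=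
  ∀ v ∈ unitDecomposable V, 0 < sec R v

/-- All sectional curvatures of `R` are nonnegative. -/
def SectionallyNonneg (R : ⋀[ℝ]^2 V →ₗ[ℝ] ⋀[ℝ]^2 V) : Prop :=
  ∀ v ∈ unitDecomposable V, 0 ≤ sec R v

variable [Fact (Module.finrank ℝ V = 4)]

/-- The bilinear form `(α, β) ↦ vol(α ∧ β)` on `⋀² V`, where `vol` is the volume form of the
oriented inner product space `V`, viewed as a linear form on `⋀⁴ V`. -/
def volPairing (o : Orientation ℝ V (Fin 4)) : ⋀[ℝ]^2 V →ₗ[ℝ] ⋀[ℝ]^2 V →ₗ[ℝ] ℝ :=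
  wedge.compr₂ (exteriorPower.alternatingMapLinearEquiv o.volumeForm)

/-- The volume form with two indices raised, as an operator `K` on `⋀² V`: the operator such that
`⟨K α, β⟩ = vol(α ∧ β)` (see `inner_volumeOperator`). -/
def volumeOperator (o : Orientation ℝ V (Fin 4)) : ⋀[ℝ]^2 V →ₗ[ℝ] ⋀[ℝ]^2 V :=
  ∑ i, ((volPairing o).flip (stdOrthonormalBasis ℝ (⋀[ℝ]^2 V) i)).smulRight
    (stdOrthonormalBasis ℝ (⋀[ℝ]^2 V) i)

theorem inner_volumeOperator (o : Orientation ℝ V (Fin 4)) (α β : ⋀[ℝ]^2 V) :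
    ⟪volumeOperator o α, β⟫ = volPairing o α β := by
  have h : volPairing o α β = ∑ i, ⟪stdOrthonormalBasis ℝ (⋀[ℝ]^2 V) i, β⟫ *
      volPairing o α (stdOrthonormalBasis ℝ (⋀[ℝ]^2 V) i) := by
    conv_lhs => rw [← (stdOrthonormalBasis ℝ (⋀[ℝ]^2 V)).sum_repr' β, map_sum]
    exact Finset.sum_congr rfl fun i _ => by rw [map_smul, smul_eq_mul]
  rw [h, volumeOperator, LinearMap.sum_apply, sum_inner]
  refine Finset.sum_congr rfl fun i _ => ?_
  rw [LinearMap.smulRight_apply, real_inner_smul_left, LinearMap.flip_apply]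
  exact mul_comm _ _

open Polynomial in
/-- The polynomial `p(x, y) = det (R - x I - y K)`, as a polynomial in `y` (the outer variable)
with coefficients in `ℝ[x]`; see `eval_detPoly`. -/
def detPoly (o : Orientation ℝ V (Fin 4)) (R : ⋀[ℝ]^2 V →ₗ[ℝ] ⋀[ℝ]^2 V) : ℝ[X][X] :=
  let b := (stdOrthonormalBasis ℝ (⋀[ℝ]^2 V)).toBasis
  Matrix.det ((LinearMap.toMatrix b b R).map (fun r => C (C r)) - C (X : ℝ[X]) • 1
    - (X : ℝ[X][X]) • (LinearMap.toMatrix b b (volumeOperator o)).map (fun r => C (C r)))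

theorem eval_detPoly (o : Orientation ℝ V (Fin 4)) (R : ⋀[ℝ]^2 V →ₗ[ℝ] ⋀[ℝ]^2 V) (x y : ℝ) :
    (detPoly o R).evalEval x y =
      LinearMap.det (R - x • LinearMap.id - y • volumeOperator o) := by
  rw [← LinearMap.det_toMatrix (stdOrthonormalBasis ℝ (⋀[ℝ]^2 V)).toBasis, detPoly,
    ← Polynomial.coe_evalEvalRingHom, RingHom.map_det,
    map_sub (LinearMap.toMatrix _ _), map_sub (LinearMap.toMatrix _ _),
    map_smul (LinearMap.toMatrix _ _), map_smul (LinearMap.toMatrix _ _), LinearMap.toMatrix_id]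
  congr 1
  ext i j
  by_cases h : i = j
  · subst h
    simp [-OrthonormalBasis.coe_toBasis, mul_comm y]
  · simp [h, mul_comm y]

open Polynomial in
/-- The polynomial `q(x) = disc_y p(x, y)`. -/
def discPoly (o : Orientation ℝ V (Fin 4)) (R : ⋀[ℝ]^2 V →ₗ[ℝ] ⋀[ℝ]^2 V) : ℝ[X] :=
  (detPoly o R).discr

end Curv4

end

/-!
Let `G` be the Grassmannian of oriented two-planes. A `2`-vector `v` is decomposable iff
`v ∧ v = 0`, i.e. iff `⟨K v, v⟩ = 0`, so `G` is cut out of the unit sphere by one more quadratic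
equation (`Curv4.mem_unitDecomposable_iff`). The operator `K` is a symmetric involution, and by
Lagrange multipliers `v ∈ G` is critical iff `R v = x v + y K v` for some `x` and `y`, where then
`x` is the critical value (`Curv4.isCriticalPoint_iff`). The curves needed for one direction rotate
the self-dual or the anti-self-dual part of `v` alone, as `G` is a product of two `2`-spheres.

Since `K² = 1`, the polynomial `p (x, ·)` is a constant multiple of the characteristic polynomial
of `K (R - x I)`, and the solutions of the Lagrange equation are the eigenvectors of this operator
for the eigenvalue `y`. An eigenvector `v` with `⟨K v, v⟩ = 0` forces the algebraic multiplicity of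
`y` to be at least `2`, because `K v` is orthogonal to `v` (`Curv4.two_le_rootMultiplicity`). So
critical values are roots of `q = disc_y p`. As `G` is compact, the sectional curvature attains its
minimum, which is a critical value and hence a root of `q`; this gives the criterion for positivity.

Conversely, if `disc q ≠ 0`, all roots of `q` are simple. Let `x` be a real one. Then `p (x, ·)`
has a multiple root `y`, and

* `y` is real: otherwise its conjugate is a second multiple root, and two multiple roots make the
  discriminant vanish to second order (`Polynomial.sq_dvd_discr_of_two_multiple_roots`);
* the curve `p = 0` is smooth at `(x, y)`: at singular points, too, the discriminant vanishes to
  second order (`Polynomial.sq_dvd_discr_of_singular`). As `p (·, y)` is the characteristic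
  polynomial of the symmetric operator `R - y K`, its eigenvalue `x` is then simple.

Hence `y` is an eigenvalue of `K (R - x I)` of geometric multiplicity one and algebraic multiplicity
at least two, and the image of a generalized eigenvector of rank two is an eigenvector `v` with
`⟨K v, v⟩ = 0` (`Curv4.exists_isotropic`), i.e. a critical point with value `x`.
-/

/-! ### Resultants and discriminants of polynomials with multiple roots -/

namespace Polynomial

variable {A : Type*} [CommRing A]

lemma sum_pow_mul_sylvester {f g : A[X]} {m n : ℕ} (hf : f.natDegree ≤ m) (hg : g.natDegree ≤ n)
    (a : A) (j : Fin (m + n)) :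
    ∑ i : Fin (m + n), a ^ (i : ℕ) * sylvester f g m n i j =
      j.addCases (fun k : Fin m => a ^ (k : ℕ) * g.eval a)
        (fun k : Fin n => a ^ (k : ℕ) * f.eval a) := by
  have key : ∀ (h : A[X]) (d k N : ℕ), h.natDegree ≤ d → k + d < N →
      ∑ i : Fin N, a ^ (i : ℕ) * (if (i : ℕ) ∈ Set.Icc k (k + d) then h.coeff (i - k) else 0) =
        a ^ k * h.eval a := by
    intro h d k N hd hN
    have hdeg : (h * X ^ k).natDegree < N := by
      have := natDegree_mul_le (p := h) (q := X ^ k)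
      have := natDegree_X_pow_le (R := A) k
      omega
    have hev : (h * X ^ k).eval a = a ^ k * h.eval a := by simp [mul_comm]
    rw [← hev, eval_eq_sum_range' hdeg, Finset.sum_range]
    refine Finset.sum_congr rfl fun i _ => ?_
    rw [mul_comm, coeff_mul_X_pow']
    congr 1
    by_cases h1 : k ≤ (i : ℕ)
    · by_cases h2 : (i : ℕ) ≤ k + d
      · simp [h1, h2]
      · simp only [Set.mem_Icc, h1, h2, and_false, if_false, if_true]
        exact (coeff_eq_zero_of_natDegree_lt (by omega)).symm
    · simp [h1]
  induction j using Fin.addCases with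
  | left k => simpa [sylvester] using key g n k (m + n) hg (by omega)
  | right k => simpa [sylvester] using key f m k (m + n) hf (by omega)

/-- If `f` and `g` have two common roots `a` and `b` modulo `c`, then `c ^ 2` divides their
resultant, up to the factor `b - a`. -/
lemma sq_dvd_sub_mul_resultant {f g : A[X]} {m n : ℕ} (hf : f.natDegree ≤ m)
    (hg : g.natDegree ≤ n) (hmn : 2 ≤ m + n) {a b c : A} (hfa : c ∣ f.eval a) (hga : c ∣ g.eval a)
    (hfb : c ∣ f.eval b) (hgb : c ∣ g.eval b) :
    c ^ 2 ∣ (b - a) * resultant f g m n := by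
  have hrow : ∀ x : A, c ∣ f.eval x → c ∣ g.eval x → ∀ j,
      c ∣ ∑ i : Fin (m + n), x ^ (i : ℕ) * sylvester f g m n i j := by
    intro x hfx hgx j
    rw [sum_pow_mul_sylvester hf hg]
    induction j using Fin.addCases with
    | left k => simpa using hgx.mul_left _
    | right k => simpa using hfx.mul_left _
  choose u hu using hrow a hfa hga
  choose w hw using hrow b hfb hgb
  set S := sylvester f g m n with hS
  let i₀ : Fin (m + n) := ⟨0, by omega⟩
  let i₁ : Fin (m + n) := ⟨1, by omega⟩
  have hi : i₁ ≠ i₀ := by simp [i₀, i₁, Fin.ext_iff]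
  -- Replacing row `0` by its combination with weights `a ^ i` keeps the determinant.
  have h1 : S.det = c * (S.updateRow i₀ u).det := by
    have := Matrix.det_updateRow_sum S i₀ (fun i => a ^ (i : ℕ))
    rw [show (∑ k : Fin (m + n), a ^ (k : ℕ) • S k) = c • u from by
      ext j; simpa [Finset.sum_apply] using hu j, Matrix.det_updateRow_smul] at this
    simpa [i₀] using this.symm
  -- The combination with weights `b ^ i - a ^ i` does not involve row `0`.
  have h2 : (b - a) * (S.updateRow i₀ u).det =
      c * ((S.updateRow i₀ u).updateRow i₁ (w - u)).det := by
    have := Matrix.det_updateRow_sum (S.updateRow i₀ u) i₁ (fun i => b ^ (i : ℕ) - a ^ (i : ℕ))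
    rw [show (∑ k : Fin (m + n), (b ^ (k : ℕ) - a ^ (k : ℕ)) • (S.updateRow i₀ u) k) = c • (w - u)
      from ?_, Matrix.det_updateRow_smul] at this
    · simpa [i₁] using this.symm
    · have : ∀ k : Fin (m + n), (b ^ (k : ℕ) - a ^ (k : ℕ)) • (S.updateRow i₀ u) k =
          (b ^ (k : ℕ) - a ^ (k : ℕ)) • S k := by
        intro k
        by_cases hk : k = i₀
        · subst hk; simp [i₀]
        · rw [Matrix.updateRow_ne hk]
      ext j
      simp only [this, Finset.sum_apply, Pi.smul_apply, smul_eq_mul, sub_mul,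
        Finset.sum_sub_distrib, hu, hw, Pi.sub_apply, mul_sub]
  refine ⟨((S.updateRow i₀ u).updateRow i₁ (w - u)).det, ?_⟩
  rw [resultant, ← hS, h1, mul_left_comm, h2]
  ring

/-- If `a` is a root of `f` modulo `c ^ 2` and of its derivative modulo `c`, then `c ^ 2` divides
the resultant of `f` and its derivative. Modulo `c ^ 2`, one has `f = (X - a) * g` with
`f' a = g a`, and this value divides both factors of `Res (X - a, f') * Res (g, f')`. -/
lemma sq_dvd_resultant_derivative {f : A[X]} (hf : IsUnit f.leadingCoeff)
    (hdeg : 2 ≤ f.natDegree) {a c : A} (hfa : c ^ 2 ∣ f.eval a) (hfa' : c ∣ f.derivative.eval a) :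
    c ^ 2 ∣ resultant f f.derivative f.natDegree (f.natDegree - 1) := by
  set I := Ideal.span {c ^ 2} with hI
  set φ := Ideal.Quotient.mk I with hφ
  have hmem : ∀ x, c ^ 2 ∣ x ↔ φ x = 0 := fun x => by
    rw [hφ, Ideal.Quotient.eq_zero_iff_mem, hI, Ideal.mem_span_singleton]
  rw [hmem, ← resultant_map_map]
  rcases subsingleton_or_nontrivial (A ⧸ I) with h | h
  · exact Subsingleton.elim _ _
  have hnd : (f.map φ).natDegree = f.natDegree :=
    natDegree_map_of_leadingCoeff_ne_zero _ (hf.map φ).ne_zero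
  have hroot : (f.map φ).IsRoot (φ a) := by
    rw [IsRoot.def, eval_map_apply, ← hmem]; exact hfa
  obtain ⟨g, hg⟩ := dvd_iff_isRoot.2 hroot
  have hgne : g ≠ 0 := by
    rintro rfl
    rw [mul_zero] at hg
    rw [hg] at hnd
    simp at hnd
    omega
  have hgdeg : 1 + g.natDegree = f.natDegree := by
    rw [← hnd, hg, (monic_X_sub_C _).natDegree_mul' hgne, natDegree_X_sub_C]
  have hder : (f.map φ).derivative = g + (X - C (φ a)) * g.derivative := by
    rw [hg, derivative_mul]; simp
  have hval : (f.derivative.map φ).eval (φ a) = g.eval (φ a) := by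
    rw [← derivative_map, hder]; simp
  have hdd : (f.derivative.map φ).natDegree ≤ f.natDegree - 1 :=
    (natDegree_map_le).trans (natDegree_derivative_le f)
  have hres : resultant (f.map φ) (f.derivative.map φ) f.natDegree (f.natDegree - 1) =
      g.eval (φ a) * resultant g (f.derivative.map φ) g.natDegree (f.natDegree - 1) := by
    have := resultant_mul_left (X - C (φ a)) g (f.derivative.map φ) (f.natDegree - 1) hdd
    rw [natDegree_X_sub_C, resultant_X_sub_C_left _ _ _ hdd, hval, ← hg, hgdeg] at this
    exact this
  obtain ⟨p, q, -, -, hpq⟩ := exists_mul_add_mul_eq_C_resultant (m := g.natDegree)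
    (n := f.natDegree - 1) g (f.derivative.map φ) le_rfl hdd (by omega)
  have hC := congrArg (eval (φ a)) hpq
  rw [eval_add, eval_mul, eval_mul, hval, eval_C] at hC
  have hsq : g.eval (φ a) * g.eval (φ a) = 0 := by
    rw [← hval, eval_map_apply, ← map_mul, ← hmem, ← sq]
    exact pow_dvd_pow_of_dvd hfa' 2
  rw [hres, ← hC]
  linear_combination (p.eval (φ a) + q.eval (φ a)) * hsq

lemma dvd_discr_iff {f : A[X]} (hf : IsUnit f.leadingCoeff) (hdeg : 0 < f.natDegree) {c : A} :
    c ∣ f.discr ↔ c ∣ resultant f f.derivative f.natDegree (f.natDegree - 1) := by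
  rw [resultant_deriv (natDegree_pos_iff_degree_pos.1 hdeg)]
  exact ((((isUnit_one.neg).pow _).mul hf).dvd_mul_left).symm

/-- Specialization commutes with the discriminant as long as the leading coefficient survives. -/
lemma map_discr_eq_zero_iff {B : Type*} [Field B] (φ : A →+* B) {f : A[X]}
    (hf : φ f.leadingCoeff ≠ 0) (hdeg : 0 < f.natDegree) :
    φ f.discr = 0 ↔
      resultant (f.map φ) (f.map φ).derivative f.natDegree (f.natDegree - 1) = 0 := by
  rw [derivative_map, resultant_map_map, resultant_deriv (natDegree_pos_iff_degree_pos.1 hdeg)]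
  simp [hf]

section Field

variable {K : Type*} [Field K] [CharZero K]

lemma resultant_derivative_eq_zero_iff {f : K[X]} (hdeg : 0 < f.natDegree) :
    resultant f f.derivative f.natDegree (f.natDegree - 1) = 0 ↔ ¬ IsCoprime f f.derivative := by
  have hf : f ≠ 0 := by rintro rfl; simp at hdeg
  rw [← natDegree_derivative f, resultant_eq_zero_iff]
  simp [hf]

/-- A polynomial with a multiple root has vanishing discriminant. -/
lemma discr_eq_zero_of_sq_dvd {f : K[X]} (hf : f ≠ 0) {a : K} (h : (X - C a) ^ 2 ∣ f) :
    f.discr = 0 := by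
  have hdeg : 2 ≤ f.natDegree := by
    simpa using natDegree_le_of_dvd h hf
  have hlc : f.leadingCoeff ≠ 0 := leadingCoeff_ne_zero.2 hf
  have hco : ¬ IsCoprime f f.derivative := by
    intro hc
    have h1 : (X - C a) ∣ f := (dvd_pow_self _ two_ne_zero).trans h
    have h2 : (X - C a) ∣ f.derivative := by
      simpa using pow_sub_one_dvd_derivative_of_pow_dvd h
    exact not_isUnit_X_sub_C a (hc.isUnit_of_dvd' h1 h2)
  have := (resultant_derivative_eq_zero_iff (f := f) (by omega)).2 hco
  rw [resultant_deriv (natDegree_pos_iff_degree_pos.1 (by omega))] at this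
  simpa [hlc] using this

end Field

end Polynomial

/-! ### Discriminants of polynomials in two variables -/

namespace Polynomial

/-- If `p (x, ·)` has two distinct multiple roots, the discriminant vanishes at `x` to second
order. -/
lemma sq_dvd_discr_of_two_multiple_roots {K : Type*} [Field K] {p : K[X][X]}
    (hp : IsUnit p.leadingCoeff) (hdeg : 2 ≤ p.natDegree) {x y z : K} (hyz : y ≠ z)
    (hy : p.evalEval x y = 0) (hy' : p.derivative.evalEval x y = 0)
    (hz : p.evalEval x z = 0) (hz' : p.derivative.evalEval x z = 0) :
    (X - C x) ^ 2 ∣ p.discr := by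
  rw [dvd_discr_iff hp (by omega)]
  have h := sq_dvd_sub_mul_resultant (f := p) (g := p.derivative) (m := p.natDegree)
    (n := p.natDegree - 1) (a := C y) (b := C z) (c := X - C x) le_rfl
    (natDegree_derivative_le p) (by omega) (dvd_iff_isRoot.2 hy) (dvd_iff_isRoot.2 hy')
    (dvd_iff_isRoot.2 hz) (dvd_iff_isRoot.2 hz')
  rw [← C_sub] at h
  exact (IsUnit.dvd_mul_left (isUnit_C.2 (sub_ne_zero.2 hyz.symm).isUnit)).1 h

/-- If `p (x, ·)` has a multiple root `y` and `p (·, y)` has the multiple root `x`, i.e. if the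
curve `p = 0` is singular at `(x, y)`, the discriminant vanishes at `x` to second order. -/
lemma sq_dvd_discr_of_singular {K : Type*} [Field K] {p : K[X][X]}
    (hp : IsUnit p.leadingCoeff) (hdeg : 2 ≤ p.natDegree) {x y : K}
    (h : (X - C x) ^ 2 ∣ p.eval (C y)) (h' : p.derivative.evalEval x y = 0) :
    (X - C x) ^ 2 ∣ p.discr := by
  rw [dvd_discr_iff hp (by omega)]
  exact sq_dvd_resultant_derivative hp hdeg h (dvd_iff_isRoot.2 h')

lemma isRoot_discr_iff {K : Type*} [Field K] [CharZero K] {p : K[X][X]}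
    (hp : IsUnit p.leadingCoeff) (hdeg : 0 < p.natDegree) (x : K) :
    p.discr.IsRoot x ↔
      ¬ IsCoprime (p.map (evalRingHom x)) (p.map (evalRingHom x)).derivative := by
  have hlc : evalRingHom x p.leadingCoeff ≠ 0 := (hp.map (evalRingHom x)).ne_zero
  have hnd : (p.map (evalRingHom x)).natDegree = p.natDegree :=
    natDegree_map_of_leadingCoeff_ne_zero _ hlc
  rw [← resultant_derivative_eq_zero_iff (by omega), hnd,
    ← map_discr_eq_zero_iff (evalRingHom x) hlc hdeg]
  rfl

/-- At a simple real root `x` of the discriminant, the multiple root of `p (x, ·)` is real: a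
non-real one would come with its complex conjugate, and two multiple roots make the discriminant
vanish to second order. -/
lemma exists_real_multiple_root {p : ℝ[X][X]} (hp : IsUnit p.leadingCoeff) (hdeg : 2 ≤ p.natDegree)
    {x : ℝ} (hx : p.discr.IsRoot x) (hsimple : ¬ (X - C x) ^ 2 ∣ p.discr) :
    ∃ y : ℝ, p.evalEval x y = 0 ∧ p.derivative.evalEval x y = 0 := by
  rw [isRoot_discr_iff hp (by omega), isCoprime_iff_aeval_ne_zero_of_isAlgClosed ℝ ℂ] at hx
  push Not at hx
  obtain ⟨z, hz, hz'⟩ := hx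
  have hev : ∀ (f : ℝ[X][X]) (w : ℂ), (f.map (mapRingHom Complex.ofRealHom)).evalEval (x : ℂ) w =
      aeval w (f.map (evalRingHom x)) := by
    intro f w
    induction f using Polynomial.induction_on' with
    | add f g hf hg => simp only [Polynomial.map_add, evalEval_add, map_add, hf, hg]
    | monomial n a =>
      have : (a.map Complex.ofRealHom).eval (x : ℂ) = ((a.eval x : ℝ) : ℂ) := by
        rw [show (x : ℂ) = Complex.ofRealHom x from rfl, eval_map_apply]; rfl
      simp [evalEval, this]
  have hconj : ∀ f : ℝ[X], aeval z f = 0 → aeval (starRingEnd ℂ z) f = 0 := by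
    intro f hf
    rw [aeval_conj, hf, map_zero]
  by_cases hreal : starRingEnd ℂ z = z
  · obtain ⟨y, rfl⟩ := Complex.conj_eq_iff_real.1 hreal
    have hof : ∀ f : ℝ[X], aeval (y : ℂ) f = 0 → f.eval y = 0 := by
      intro f hf
      have := aeval_algebraMap_apply ℂ y f
      rw [Complex.coe_algebraMap, hf] at this
      simpa using this.symm
    refine ⟨y, ?_, ?_⟩
    · rw [← eval₂_evalRingHom, ← eval_map]; exact hof _ hz
    · rw [← eval₂_evalRingHom, ← eval_map, ← derivative_map]; exact hof _ hz'
  · exfalso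
    apply hsimple
    set P := p.map (mapRingHom Complex.ofRealHom) with hP
    have hinj : Function.Injective (mapRingHom Complex.ofRealHom) :=
      map_injective _ Complex.ofRealHom.injective
    have hlc : IsUnit P.leadingCoeff := by
      rw [hP, leadingCoeff_map_of_injective hinj]; exact hp.map _
    have hnd : P.natDegree = p.natDegree := natDegree_map_eq_of_injective hinj p
    rw [derivative_map] at hz'
    have key := sq_dvd_discr_of_two_multiple_roots (p := P) (x := (x : ℂ)) hlc (by omega)
      (Ne.symm hreal) (by rw [hev, hz]) (by rw [hP, derivative_map, hev, hz'])
      (by rw [hev]; exact hconj _ hz) (by rw [hP, derivative_map, hev]; exact hconj _ hz')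
    rw [dvd_discr_iff hlc (by omega), hnd, hP, derivative_map, resultant_map_map,
      coe_mapRingHom] at key
    rw [dvd_discr_iff hp (by omega), ← map_dvd_map _ Complex.ofRealHom.injective
      ((monic_X_sub_C x).pow 2)]
    simpa using key

end Polynomial

/-! ### The volume operator and decomposable `2`-vectors -/

namespace Curv4

section Coordinates

variable {V : Type*} [NormedAddCommGroup V] [InnerProductSpace ℝ V]

lemma volPairing_wedge₂ [Fact (Module.finrank ℝ V = 4)] (o : Orientation ℝ V (Fin 4))
    (a b c d : V) : volPairing o (wedge₂ a b) (wedge₂ c d) = o.volumeForm ![a, b, c, d] := by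
  have h : wedge (wedge₂ a b) (wedge₂ c d) = exteriorPower.ιMulti ℝ 4 ![a, b, c, d] := by
    apply Subtype.ext
    simp [wedge, wedge₂, ExteriorAlgebra.ιMulti_apply, mul_assoc]
  rw [volPairing, LinearMap.compr₂_apply, h, exteriorPower.alternatingMapLinearEquiv_apply_ιMulti]

variable [FiniteDimensional ℝ V]

lemma inner_wedge₂ (a b c d : V) :
    ⟪wedge₂ a b, wedge₂ c d⟫ = ⟪a, c⟫ * ⟪b, d⟫ - ⟪a, d⟫ * ⟪b, c⟫ := by
  rw [wedge₂, wedge₂, exteriorPower.inner_ιMulti_ιMulti, Matrix.det_fin_two]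
  simp [mul_comm]

/-- The first indices of the `2`-vectors `e₀₁, e₀₂, e₀₃, e₂₃, e₃₁, e₁₂`. The order is such that the
volume operator of an oriented orthonormal basis exchanges the `i`-th and the `(i + 3)`-th. -/
def fstIndex : Fin 6 → Fin 4 := ![0, 0, 0, 2, 3, 1]

/-- The second indices of the `2`-vectors `e₀₁, e₀₂, e₀₃, e₂₃, e₃₁, e₁₂`. -/
def sndIndex : Fin 6 → Fin 4 := ![1, 2, 3, 3, 1, 2]

lemma orthonormal_wedge₂ (e : OrthonormalBasis (Fin 4) ℝ V) :
    Orthonormal ℝ fun i => wedge₂ (e (fstIndex i)) (e (sndIndex i)) := by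
  rw [orthonormal_iff_ite]
  intro i j
  rw [inner_wedge₂]
  simp only [e.inner_eq_ite]
  fin_cases i <;> fin_cases j <;> simp [fstIndex, sndIndex]

variable [Fact (Module.finrank ℝ V = 4)]

lemma finrank_exteriorPower_two : Module.finrank ℝ (⋀[ℝ]^2 V) = 6 := by
  rw [exteriorPower.finrank_eq, (Fact.out : Module.finrank ℝ V = 4)]
  decide

/-- The orthonormal basis `e₀₁, e₀₂, e₀₃, e₂₃, e₃₁, e₁₂` of `⋀² V` induced by an orthonormal basis
of `V`. -/
noncomputable def wedgeBasis (e : OrthonormalBasis (Fin 4) ℝ V) :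
    OrthonormalBasis (Fin 6) ℝ (⋀[ℝ]^2 V) :=
  (basisOfOrthonormalOfCardEqFinrank (orthonormal_wedge₂ e)
    (by rw [finrank_exteriorPower_two, Fintype.card_fin])).toOrthonormalBasis (by
      simpa using orthonormal_wedge₂ e)

lemma wedgeBasis_apply (e : OrthonormalBasis (Fin 4) ℝ V) (i : Fin 6) :
    wedgeBasis e i = wedge₂ (e (fstIndex i)) (e (sndIndex i)) := by
  simp [wedgeBasis]

/-- A positively oriented orthonormal basis of `V`. -/
noncomputable def orientedBasis (o : Orientation ℝ V (Fin 4)) : OrthonormalBasis (Fin 4) ℝ V :=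
  o.finOrthonormalBasis (by norm_num) Fact.out

lemma volPairing_wedgeBasis (o : Orientation ℝ V (Fin 4)) (i j : Fin 6) :
    volPairing o (wedgeBasis (orientedBasis o) i) (wedgeBasis (orientedBasis o) j) =
      if j = i + 3 then 1 else 0 := by
  have hdet : ∀ s : Fin 4 → Fin 4, o.volumeForm (orientedBasis o ∘ s) =
      (((1 : Matrix (Fin 4) (Fin 4) ℤ).submatrix id s).det : ℝ) := by
    intro s
    rw [o.volumeForm_robust (orientedBasis o)
      (o.finOrthonormalBasis_orientation (by norm_num) Fact.out), Module.Basis.det_apply,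
      Int.cast_det]
    congr 1
    ext k l
    simp [Module.Basis.toMatrix_apply, Matrix.one_apply]
  have htable : ∀ i j : Fin 6, ((1 : Matrix (Fin 4) (Fin 4) ℤ).submatrix id
      ![fstIndex i, sndIndex i, fstIndex j, sndIndex j]).det = if j = i + 3 then 1 else 0 := by
    decide +kernel
  have hcomp : ![orientedBasis o (fstIndex i), orientedBasis o (sndIndex i),
      orientedBasis o (fstIndex j), orientedBasis o (sndIndex j)] =
      orientedBasis o ∘ ![fstIndex i, sndIndex i, fstIndex j, sndIndex j] := by
    ext k
    fin_cases k <;> rfl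
  rw [wedgeBasis_apply, wedgeBasis_apply, volPairing_wedge₂, hcomp, hdet, htable]
  push_cast
  rfl

lemma volumeOperator_wedgeBasis (o : Orientation ℝ V (Fin 4)) (i : Fin 6) :
    volumeOperator o (wedgeBasis (orientedBasis o) i) = wedgeBasis (orientedBasis o) (i + 3) := by
  refine (wedgeBasis (orientedBasis o)).repr.injective (PiLp.ext fun j => ?_)
  rw [OrthonormalBasis.repr_apply_apply, OrthonormalBasis.repr_apply_apply, real_inner_comm,
    inner_volumeOperator, volPairing_wedgeBasis,
    OrthonormalBasis.inner_eq_ite]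

lemma volumeOperator_volumeOperator (o : Orientation ℝ V (Fin 4)) (v : ⋀[ℝ]^2 V) :
    volumeOperator o (volumeOperator o v) = v := by
  have : volumeOperator o ∘ₗ volumeOperator o = LinearMap.id := by
    refine (wedgeBasis (orientedBasis o)).toBasis.ext fun i => ?_
    simp only [OrthonormalBasis.coe_toBasis, LinearMap.comp_apply, volumeOperator_wedgeBasis,
      LinearMap.id_apply]
    congr 1
    fin_cases i <;> rfl
  exact LinearMap.congr_fun this v

lemma inner_volumeOperator_eq_sum (o : Orientation ℝ V (Fin 4)) (v w : ⋀[ℝ]^2 V) :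
    ⟪volumeOperator o v, w⟫ = ∑ i, ⟪wedgeBasis (orientedBasis o) i, v⟫ *
      ⟪wedgeBasis (orientedBasis o) (i + 3), w⟫ := by
  conv_lhs => rw [← (wedgeBasis (orientedBasis o)).sum_repr' v]
  simp [map_sum, sum_inner, real_inner_smul_left, volumeOperator_wedgeBasis]

lemma isSymmetric_volumeOperator (o : Orientation ℝ V (Fin 4)) :
    (volumeOperator o).IsSymmetric := by
  intro v w
  rw [real_inner_comm (volumeOperator o w) v, inner_volumeOperator_eq_sum,
    inner_volumeOperator_eq_sum, Fin.sum_univ_six, Fin.sum_univ_six]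
  simp only [show (3 : Fin 6) + 3 = 0 from rfl, show (4 : Fin 6) + 3 = 1 from rfl,
    show (5 : Fin 6) + 3 = 2 from rfl, show (0 : Fin 6) + 3 = 3 from rfl,
    show (1 : Fin 6) + 3 = 4 from rfl, show (2 : Fin 6) + 3 = 5 from rfl]
  ring

lemma inner_volumeOperator_wedge₂_self (o : Orientation ℝ V (Fin 4)) (a b : V) :
    ⟪volumeOperator o (wedge₂ a b), wedge₂ a b⟫ = 0 := by
  rw [inner_volumeOperator, volPairing_wedge₂]
  exact o.volumeForm.map_eq_zero_of_eq (i := 0) (j := 2) _ rfl (by decide)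

/-- A `2`-vector `v` with `v ∧ v = 0` is decomposable: if its coordinate `p i j` with respect to
an orthonormal basis `e` is non-zero, the Plücker relation gives
`p i j • v = (∑ k, p i k • e k) ∧ (∑ l, p j l • e l)`. -/
lemma exists_eq_wedge₂ (o : Orientation ℝ V (Fin 4)) {v : ⋀[ℝ]^2 V}
    (h : ⟪volumeOperator o v, v⟫ = 0) : ∃ a b : V, v = wedge₂ a b := by
  set e := orientedBasis o with he
  set F := wedgeBasis e with hF
  rcases eq_or_ne v 0 with rfl | hv
  · exact ⟨0, 0, ((exteriorPower.ιMulti ℝ 2).map_coord_zero 0 rfl).symm⟩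
  let p : Fin 4 → Fin 4 → ℝ := fun i j => ⟪wedge₂ (e i) (e j), v⟫
  have hskew : ∀ i j, p i j = - p j i := by
    intro i j
    simp only [p]
    rw [← inner_neg_left]
    congr 1
    simp only [wedge₂]
    have := (exteriorPower.ιMulti ℝ 2 (M := V)).map_swap ![e j, e i]
      (i := 0) (j := 1) (by decide)
    rw [← this]
    congr 1
    ext k
    fin_cases k <;> rfl
  have hpF : ∀ i, ⟪F i, v⟫ = p (fstIndex i) (sndIndex i) := fun i => by
    rw [hF, wedgeBasis_apply]
  obtain ⟨m, hm⟩ : ∃ m, ⟪F m, v⟫ ≠ 0 := by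
    by_contra! hall
    apply hv
    rw [← F.sum_repr' v]
    simp [hall]
  have hpl : p 0 1 * p 2 3 + p 0 2 * p 3 1 + p 0 3 * p 1 2 = 0 := by
    rw [inner_volumeOperator_eq_sum, Fin.sum_univ_six] at h
    simp only [← he, ← hF, hpF, show (3 : Fin 6) + 3 = 0 from rfl,
      show (4 : Fin 6) + 3 = 1 from rfl, show (5 : Fin 6) + 3 = 2 from rfl,
      show (0 : Fin 6) + 3 = 3 from rfl, show (1 : Fin 6) + 3 = 4 from rfl,
      show (2 : Fin 6) + 3 = 5 from rfl] at h
    simp [fstIndex, sndIndex] at h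
    linarith
  have hplucker : ∀ n, p (fstIndex m) (fstIndex n) * p (sndIndex m) (sndIndex n) -
      p (fstIndex m) (sndIndex n) * p (sndIndex m) (fstIndex n) =
      p (fstIndex m) (sndIndex m) * p (fstIndex n) (sndIndex n) := by
    have h0 : ∀ i, p i i = 0 := fun i => by linarith [hskew i i]
    intro n
    fin_cases m <;> fin_cases n <;>
      simp [fstIndex, sndIndex, h0, hskew 1 0, hskew 2 0, hskew 3 0, hskew 3 2, hskew 2 1,
        hskew 1 3] <;>
      first | ring1 | linear_combination hpl | linear_combination -hpl
  rw [hpF] at hm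
  refine ⟨(p (fstIndex m) (sndIndex m))⁻¹ • ∑ k, p (fstIndex m) k • e k,
    ∑ l, p (sndIndex m) l • e l, ?_⟩
  refine F.repr.injective (PiLp.ext fun n => ?_)
  have hinner : ∀ (c : Fin 4 → ℝ) k, ⟪e k, ∑ l, c l • e l⟫ = c k := fun c k => by
    simp [inner_sum, inner_smul_right, e.inner_eq_ite]
  rw [F.repr_apply_apply, F.repr_apply_apply, hpF, hF, wedgeBasis_apply, inner_wedge₂]
  simp only [inner_smul_right, hinner]
  field_simp
  linarith [hplucker n]

lemma mem_unitDecomposable_iff (o : Orientation ℝ V (Fin 4)) (v : ⋀[ℝ]^2 V) :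
    v ∈ unitDecomposable V ↔ ⟪volumeOperator o v, v⟫ = 0 ∧ ‖v‖ = 1 := by
  refine and_congr_left fun _ => ⟨?_, exists_eq_wedge₂ o⟩
  rintro ⟨a, b, rfl⟩
  exact inner_volumeOperator_wedge₂_self o a b

end Coordinates

end Curv4

/-! ### The characteristic polynomials behind `p (x, y)` -/

namespace Curv4
variable {V : Type*} [NormedAddCommGroup V] [InnerProductSpace ℝ V]
  [FiniteDimensional ℝ V] [Fact (Module.finrank ℝ V = 4)]

open Polynomial

lemma det_neg_twoForms (f : ⋀[ℝ]^2 V →ₗ[ℝ] ⋀[ℝ]^2 V) : LinearMap.det (-f) = LinearMap.det f := by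
  rw [← neg_one_smul ℝ f, LinearMap.det_smul, finrank_exteriorPower_two]
  norm_num

/-- For fixed `y`, the polynomial `p (x, y)` is the characteristic polynomial of `R - y K`. -/
lemma eval_C_detPoly (o : Orientation ℝ V (Fin 4)) (R : ⋀[ℝ]^2 V →ₗ[ℝ] ⋀[ℝ]^2 V) (y : ℝ) :
    (detPoly o R).eval (C y) = (R - y • volumeOperator o).charpoly := by
  refine Polynomial.funext fun x => ?_
  rw [LinearMap.eval_charpoly, ← det_neg_twoForms]
  refine (eval_detPoly o R x y).trans (congrArg _ ?_)
  refine LinearMap.ext fun v => ?_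
  simp [Module.algebraMap_end_apply]
  abel

lemma det_volumeOperator_ne_zero (o : Orientation ℝ V (Fin 4)) :
    LinearMap.det (volumeOperator o) ≠ 0 := by
  intro h
  have := congrArg LinearMap.det
    (LinearMap.ext (volumeOperator_volumeOperator o) : volumeOperator o ∘ₗ volumeOperator o = .id)
  rw [LinearMap.det_comp, h, LinearMap.det_id] at this
  norm_num at this

/-- For fixed `x`, the polynomial `p (x, y)` is, up to the constant `det K`, the characteristic
polynomial of `K (R - x I)`, as `K` is an involution. -/
lemma map_evalRingHom_detPoly (o : Orientation ℝ V (Fin 4)) (R : ⋀[ℝ]^2 V →ₗ[ℝ] ⋀[ℝ]^2 V) (x : ℝ) :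
    (detPoly o R).map (evalRingHom x) = C (LinearMap.det (volumeOperator o)) *
      (volumeOperator o ∘ₗ (R - x • LinearMap.id)).charpoly := by
  refine Polynomial.funext fun y => ?_
  rw [eval_mul, eval_C, LinearMap.eval_charpoly, eval_map, eval₂_evalRingHom, eval_detPoly,
    ← det_neg_twoForms (_ - _), ← LinearMap.det_comp]
  congr 1
  refine LinearMap.ext fun v => ?_
  simp [Module.algebraMap_end_apply, volumeOperator_volumeOperator]

lemma natDegree_detPoly_and_leadingCoeff (o : Orientation ℝ V (Fin 4))
    (R : ⋀[ℝ]^2 V →ₗ[ℝ] ⋀[ℝ]^2 V) : (detPoly o R).natDegree = 6 ∧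
      (detPoly o R).leadingCoeff = C (LinearMap.det (volumeOperator o)) := by
  have hd := det_volumeOperator_ne_zero o
  have hcoeff : ∀ n x, ((detPoly o R).coeff n).eval x = LinearMap.det (volumeOperator o) *
      (volumeOperator o ∘ₗ (R - x • LinearMap.id)).charpoly.coeff n := fun n x => by
    have := congrArg (coeff · n) (map_evalRingHom_detPoly o R x)
    simpa using this
  have hdeg : ∀ f : ⋀[ℝ]^2 V →ₗ[ℝ] ⋀[ℝ]^2 V, f.charpoly.natDegree = 6 := fun f => by
    rw [LinearMap.charpoly_natDegree, finrank_exteriorPower_two]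
  have h6 : (detPoly o R).coeff 6 = C (LinearMap.det (volumeOperator o)) := by
    refine Polynomial.funext fun x => ?_
    have := LinearMap.charpoly_monic (volumeOperator o ∘ₗ (R - x • LinearMap.id))
    rw [Monic, leadingCoeff, hdeg] at this
    rw [hcoeff, eval_C, this, mul_one]
  have hn : (detPoly o R).natDegree = 6 := by
    refine natDegree_eq_of_le_of_coeff_ne_zero ?_ (by rw [h6]; simpa using hd)
    refine natDegree_le_iff_coeff_eq_zero.2 fun n hn => Polynomial.funext fun x => ?_
    rw [hcoeff, coeff_eq_zero_of_natDegree_lt (by rw [hdeg]; exact hn), mul_zero, eval_zero]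
  exact ⟨hn, by rw [leadingCoeff, hn, h6]⟩

lemma isUnit_leadingCoeff_detPoly (o : Orientation ℝ V (Fin 4))
    (R : ⋀[ℝ]^2 V →ₗ[ℝ] ⋀[ℝ]^2 V) : IsUnit (detPoly o R).leadingCoeff := by
  rw [(natDegree_detPoly_and_leadingCoeff o R).2]
  exact isUnit_C.2 (det_volumeOperator_ne_zero o).isUnit

variable {o : Orientation ℝ V (Fin 4)} {R : ⋀[ℝ]^2 V →ₗ[ℝ] ⋀[ℝ]^2 V}

/-- `v` is a solution of the Lagrange multiplier equation `R v = x v + y K v` exactly if it is an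
eigenvector of `K (R - x I)` with eigenvalue `y`. -/
lemma mem_eigenspace_iff (x y : ℝ) (v : ⋀[ℝ]^2 V) :
    v ∈ Module.End.eigenspace (volumeOperator o ∘ₗ (R - x • LinearMap.id)) y ↔
      R v = x • v + y • volumeOperator o v := by
  have hinj := Function.Involutive.injective (volumeOperator_volumeOperator o)
  rw [Module.End.mem_eigenspace_iff, ← hinj.eq_iff, LinearMap.comp_apply,
    volumeOperator_volumeOperator, map_smul, LinearMap.sub_apply, LinearMap.smul_apply,
    LinearMap.id_apply, sub_eq_iff_eq_add']

/-- A `K`-isotropic solution of the Lagrange multiplier equation makes `y` a multiple root of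
`p (x, ·)`: if the eigenspace of `K (R - x I)` is a line spanned by `v`, then `K v` is orthogonal
to the kernel of the symmetric operator `R - x I - y K`, hence in its range, and this yields a
generalized eigenvector which is not an eigenvector. -/
lemma two_le_rootMultiplicity (hR : R.IsSymmetric) {x y : ℝ} {v : ⋀[ℝ]^2 V} (hv : v ≠ 0)
    (hKv : ⟪volumeOperator o v, v⟫ = 0) (hRv : R v = x • v + y • volumeOperator o v) :
    2 ≤ (volumeOperator o ∘ₗ (R - x • LinearMap.id)).charpoly.rootMultiplicity y := by
  set M : Module.End ℝ (⋀[ℝ]^2 V) := volumeOperator o ∘ₗ (R - x • LinearMap.id) with hM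
  have hvM : v ∈ M.eigenspace y := (mem_eigenspace_iff x y v).2 hRv
  by_cases h1 : 2 ≤ Module.finrank ℝ (M.eigenspace y)
  · exact h1.trans (LinearMap.finrank_eigenspace_le M y)
  · set A : ⋀[ℝ]^2 V →ₗ[ℝ] ⋀[ℝ]^2 V := R - x • LinearMap.id - y • volumeOperator o with hA
    have hAv : ∀ w, A w = R w - x • w - y • volumeOperator o w := fun w => rfl
    have hAsymm : A.IsSymmetric := fun u w => by
      simp only [hAv, inner_sub_left, inner_sub_right, real_inner_smul_left, inner_smul_right,
        hR u w, isSymmetric_volumeOperator o u w]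
    have hker : LinearMap.ker A = M.eigenspace y := by
      ext w
      rw [mem_eigenspace_iff, LinearMap.mem_ker, hAv, sub_sub, sub_eq_zero]
    have hspan : M.eigenspace y = Submodule.span ℝ {v} := by
      refine (Submodule.eq_of_le_of_finrank_le ?_ ?_).symm
      · rwa [Submodule.span_singleton_le_iff_mem]
      · rw [finrank_span_singleton hv]; omega
    obtain ⟨u, hu⟩ : volumeOperator o v ∈ LinearMap.range A := by
      rw [← Submodule.orthogonal_orthogonal (LinearMap.range A), hAsymm.orthogonal_range, hker,
        hspan, Submodule.mem_orthogonal_singleton_iff_inner_right]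
      rw [real_inner_comm]; exact hKv
    have hMu : (M - algebraMap ℝ _ y) u = v := by
      have : (M - algebraMap ℝ _ y) u = volumeOperator o (A u) := by
        simp [hAv, hM, Module.algebraMap_end_apply, volumeOperator_volumeOperator]
      rw [this, hu, volumeOperator_volumeOperator]
    have hgen : u ∈ M.genEigenspace y 2 := by
      rw [show (2 : ℕ∞) = ((2 : ℕ) : ℕ∞) from rfl, Module.End.mem_genEigenspace_nat, pow_two,
        LinearMap.mem_ker]
      have h2 := Module.End.mem_eigenspace_iff.1 hvM
      have h3 : (M - y • (1 : Module.End ℝ (⋀[ℝ]^2 V))) u = v := hMu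
      rw [Module.End.mul_apply, h3]
      simp [h2]
    have hune : u ∉ M.eigenspace y := fun hc => by
      rw [← hker, LinearMap.mem_ker, hu] at hc
      apply hv
      rw [← volumeOperator_volumeOperator o v, hc, map_zero]
    have hlt : M.eigenspace y < M.genEigenspace y 2 := by
      refine lt_of_le_of_ne ?_ fun hc => hune (hc ▸ hgen)
      exact (M.genEigenspace y).mono (by norm_num)
    have := Submodule.finrank_lt_finrank_of_lt hlt
    have h1' : Module.finrank ℝ (M.eigenspace y) = 1 := by
      rw [hspan, finrank_span_singleton hv]
    exact (by omega : 2 ≤ Module.finrank ℝ (M.genEigenspace y 2)).trans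
      (LinearMap.finrank_genEigenspace_le M y 2)

/-- Conversely, at a multiple root `y` of `p (x, ·)` where the curve `p = 0` is not singular, there
is a `K`-isotropic solution of the Lagrange multiplier equation. -/
lemma exists_isotropic (hR : R.IsSymmetric) {x y : ℝ}
    (hy : 2 ≤ (volumeOperator o ∘ₗ (R - x • LinearMap.id)).charpoly.rootMultiplicity y)
    (hx : (R - y • volumeOperator o).charpoly.rootMultiplicity x < 2) :
    ∃ v ≠ 0, ⟪volumeOperator o v, v⟫ = 0 ∧ R v = x • v + y • volumeOperator o v := by
  set M : Module.End ℝ (⋀[ℝ]^2 V) := volumeOperator o ∘ₗ (R - x • LinearMap.id) with hM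
  set N : Module.End ℝ (⋀[ℝ]^2 V) := R - y • volumeOperator o with hN
  have hNM : N.eigenspace x = M.eigenspace y := by
    ext w
    rw [mem_eigenspace_iff, Module.End.mem_eigenspace_iff, hN, LinearMap.sub_apply,
      LinearMap.smul_apply, sub_eq_iff_eq_add]
  have hle : M.eigenspace y ≤ M.maxGenEigenspace y := (M.genEigenspace y).mono le_top
  have hlt : M.eigenspace y < M.maxGenEigenspace y := by
    refine lt_of_le_of_ne hle fun hc => ?_
    have h1 := LinearMap.finrank_eigenspace_le N x
    have h2 := LinearMap.finrank_maxGenEigenspace_eq M y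
    rw [← hc, ← hNM] at h2
    omega
  -- If the kernels of a power and the next power agree, all later ones do.
  have h2 : M.eigenspace y < M.genEigenspace y 2 := by
    refine lt_of_le_of_ne ((M.genEigenspace y).mono (by norm_num)) fun hc => hlt.ne ?_
    refine le_antisymm hle fun u hu => ?_
    rw [Module.End.mem_maxGenEigenspace] at hu
    obtain ⟨k, hk⟩ := hu
    rw [Module.End.eigenspace, ← Nat.cast_one, show (2 : ℕ∞) = ((2 : ℕ) : ℕ∞) from rfl,
      Module.End.genEigenspace_nat, Module.End.genEigenspace_nat] at hc
    rw [Module.End.eigenspace, ← Nat.cast_one, Module.End.genEigenspace_nat,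
      Module.End.ker_pow_constant hc k, LinearMap.mem_ker, pow_add, Module.End.mul_apply, hk,
      map_zero]
  obtain ⟨u, hu2, hu1⟩ := SetLike.exists_of_lt h2
  set v := (M - y • (1 : Module.End ℝ (⋀[ℝ]^2 V))) u with hv
  rw [show (2 : ℕ∞) = ((2 : ℕ) : ℕ∞) from rfl, Module.End.mem_genEigenspace_nat, pow_two,
    LinearMap.mem_ker, Module.End.mul_apply, ← hv] at hu2
  have hvne : v ≠ 0 := fun hc => hu1 (by
    rw [Module.End.mem_eigenspace_iff]
    simpa [hv, sub_eq_zero] using hc)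
  have hRv : R v = x • v + y • volumeOperator o v := by
    rw [← mem_eigenspace_iff, Module.End.mem_eigenspace_iff]
    exact sub_eq_zero.1 hu2
  refine ⟨v, hvne, ?_, hRv⟩
  -- `K v` is the image of `u` under the symmetric operator `R - x I - y K`, which kills `v`.
  have hKv : volumeOperator o v = R u - x • u - y • volumeOperator o u := by
    simp [hv, hM, volumeOperator_volumeOperator]
  rw [hKv, inner_sub_left, inner_sub_left, hR, hRv, real_inner_smul_left, real_inner_smul_left,
    isSymmetric_volumeOperator o u v, inner_add_right, inner_smul_right, inner_smul_right]
  ring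

end Curv4

/-! ### Critical points of the sectional curvature -/

namespace Curv4
variable {V : Type*} [NormedAddCommGroup V] [InnerProductSpace ℝ V]
  [FiniteDimensional ℝ V]

lemma hasDerivAt_sec_comp {R : ⋀[ℝ]^2 V →ₗ[ℝ] ⋀[ℝ]^2 V} (hR : R.IsSymmetric)
    {γ : ℝ → ⋀[ℝ]^2 V} {γ' : ⋀[ℝ]^2 V} {t : ℝ} (hγ : HasDerivAt γ γ' t) :
    HasDerivAt (fun s => sec R (γ s)) (2 * ⟪γ', R (γ t)⟫) t := by
  have h1 : HasDerivAt (fun s => R (γ s)) (R γ') t :=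
    (LinearMap.toContinuousLinearMap R).hasFDerivAt.comp_hasDerivAt t hγ
  have h2 : 2 * ⟪γ', R (γ t)⟫ = ⟪γ t, R γ'⟫ + ⟪γ', R (γ t)⟫ := by
    rw [← hR (γ t) γ', real_inner_comm]
    ring
  rw [h2]
  exact hγ.inner ℝ h1

variable [Fact (Module.finrank ℝ V = 4)]

variable {o : Orientation ℝ V (Fin 4)} {R : ⋀[ℝ]^2 V →ₗ[ℝ] ⋀[ℝ]^2 V}

/-- With `s = 1` and `s = -1`, the vector `v + s K v` is twice the (anti-)self-dual part of `v`, and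
rotating that part alone is a motion in the Grassmannian. At a critical point, this makes the
(anti-)self-dual part of `R v` parallel to that of `v`. -/
lemma IsCriticalPoint.exists_smul_eq (hR : R.IsSymmetric) {v : ⋀[ℝ]^2 V}
    (hv : IsCriticalPoint R v) {s : ℝ} (hs : s * s = 1) :
    ∃ c : ℝ, R v + s • volumeOperator o (R v) = c • (v + s • volumeOperator o v) := by
  obtain ⟨hmem, hcrit⟩ := hv
  obtain ⟨hKv, hnorm⟩ := (mem_unitDecomposable_iff o v).1 hmem
  set K := volumeOperator o with hK
  have hKK : ∀ w, K (K w) = w := volumeOperator_volumeOperator o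
  have hKs : K.IsSymmetric := isSymmetric_volumeOperator o
  set v₁ := v + s • K v with hv₁
  set v₂ := v - s • K v with hv₂
  have hvv : ⟪v, v⟫ = 1 := by rw [real_inner_self_eq_norm_sq, hnorm]; norm_num
  have hvK : ⟪v, K v⟫ = 0 := by rw [← hKs, hKv]
  have hKvKv : ⟪K v, K v⟫ = 1 := by rw [hKs, hKK, hvv]
  have hn₁ : ⟪v₁, v₁⟫ = 2 := by
    simp only [hv₁, inner_add_left, inner_add_right, real_inner_smul_left, inner_smul_right, hvv,
      hvK, hKv, hKvKv]
    linear_combination hs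
  have hn₂ : ⟪v₂, v₂⟫ = 2 := by
    simp only [hv₂, inner_sub_left, inner_sub_right, real_inner_smul_left, inner_smul_right, hvv,
      hvK, hKv, hKvKv]
    linear_combination hs
  have hsK : ∀ w, K (w + s • K w) = s • (w + s • K w) := fun w => by
    rw [map_add, map_smul, hKK, smul_add, smul_smul, hs, one_smul, add_comm]
  have hK₁ : K v₁ = s • v₁ := hsK v
  have hK₂ : K v₂ = -s • v₂ := by
    rw [hv₂, map_sub, map_smul, hKK, smul_sub, smul_smul, neg_mul, hs, neg_smul, neg_smul, one_smul]
    abel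
  have horth : ∀ w₁ w₂, K w₁ = s • w₁ → K w₂ = -s • w₂ → ⟪w₁, w₂⟫ = 0 := by
    intro w₁ w₂ h₁ h₂
    have := hKs w₁ w₂
    rw [h₁, h₂, real_inner_smul_left, inner_smul_right] at this
    have hs0 : s ≠ 0 := by rintro rfl; norm_num at hs
    have : s * ⟪w₁, w₂⟫ = 0 := by linarith
    exact (mul_eq_zero.1 this).resolve_left hs0
  -- The component of `R v` orthogonal to `v₁` is shown to vanish by moving `v₁` in its direction.
  set c := ⟪v₁, R v + s • K (R v)⟫ / 2 with hc
  set w := (R v + s • K (R v)) - c • v₁ with hw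
  have hKw : K w = s • w := by
    rw [hw, map_sub, hsK, map_smul, hK₁, smul_sub, smul_comm]
  have hwv : ⟪v₁, w⟫ = 0 := by
    rw [hw, inner_sub_right, inner_smul_right, hn₁, hc]; ring
  refine ⟨c, ?_⟩
  rw [← sub_eq_zero, ← hw]
  by_contra hw0
  have hww : 0 < ⟪w, w⟫ := real_inner_self_pos.2 hw0
  -- `r • w` has the length of `v₁`, so that rotating `v₁` towards it keeps the length.
  set r := Real.sqrt (2 / ⟪w, w⟫) with hr
  have hrr : r * r * ⟪w, w⟫ = 2 := by
    rw [hr, Real.mul_self_sqrt (by positivity)]; field_simp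
  have hr0 : r ≠ 0 := by rintro h; rw [h] at hrr; norm_num at hrr
  let γ : ℝ → ⋀[ℝ]^2 V := fun t =>
    (1 / 2 : ℝ) • (Real.cos t • v₁ + (Real.sin t * r) • w + v₂)
  have hγs : ContDiff ℝ ∞ γ := by
    have hcos : ContDiff ℝ ∞ Real.cos := Real.contDiff_cos
    have hsin : ContDiff ℝ ∞ Real.sin := Real.contDiff_sin
    fun_prop
  have hγmem : ∀ t, γ t ∈ unitDecomposable V := by
    intro t
    set u := Real.cos t • v₁ + (Real.sin t * r) • w with hu
    have hKu : K u = s • u := by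
      rw [hu, map_add, map_smul, map_smul, hK₁, hKw]
      module
    have huu : ⟪u, u⟫ = 2 := by
      simp only [hu, inner_add_left, inner_add_right, real_inner_smul_left, inner_smul_right, hn₁,
        hwv, real_inner_comm v₁ w]
      linear_combination (Real.sin t) ^ 2 * hrr + 2 * Real.sin_sq_add_cos_sq t
    have huv : ⟪u, v₂⟫ = 0 := horth u v₂ hKu hK₂
    have hvu : ⟪v₂, u⟫ = 0 := by rw [real_inner_comm, huv]
    have hγt : γ t = (1 / 2 : ℝ) • (u + v₂) := rfl
    rw [mem_unitDecomposable_iff o, hγt]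
    constructor
    · simp only [← hK, map_smul, map_add, hKu, hK₂, inner_add_left, inner_add_right,
        real_inner_smul_left, inner_smul_right, huu, hn₂, huv, hvu]
      ring
    · have : ⟪(1 / 2 : ℝ) • (u + v₂), (1 / 2 : ℝ) • (u + v₂)⟫ = 1 := by
        simp only [inner_add_left, inner_add_right, real_inner_smul_left, inner_smul_right, huu,
          hn₂, huv, hvu]
        norm_num
      rw [real_inner_self_eq_norm_sq] at this
      exact (pow_eq_one_iff_of_nonneg (norm_nonneg _) two_ne_zero).1 this
  have hγ0 : γ 0 = v := by
    simp only [γ, hv₁, hv₂, Real.cos_zero, Real.sin_zero, one_smul, zero_mul, zero_smul, add_zero]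
    module
  have hγ' : HasDerivAt γ ((1 / 2 : ℝ) • (r • w)) 0 := by
    have h1 := ((Real.hasDerivAt_cos 0).smul_const v₁)
    have h2 := (((Real.hasDerivAt_sin 0).mul_const r).smul_const w)
    have h3 := ((h1.add h2).add_const v₂).const_smul (1 / 2 : ℝ)
    refine HasDerivAt.congr_deriv h3 ?_
    rw [Real.sin_zero, Real.cos_zero, neg_zero, zero_smul, zero_add, one_mul]
  have hzero := (hasDerivAt_sec_comp hR hγ').unique (hcrit γ hγs hγmem hγ0)
  rw [hγ0, real_inner_smul_left, real_inner_smul_left] at hzero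
  have hwR : ⟪w, R v⟫ = 0 := by
    have : r * ⟪w, R v⟫ = 0 := by linarith
    exact (mul_eq_zero.1 this).resolve_left hr0
  have : ⟪w, w⟫ = 2 * ⟪w, R v⟫ := by
    nth_rewrite 2 [hw]
    rw [inner_sub_right, inner_smul_right, real_inner_comm v₁ w, hwv, inner_add_right,
      inner_smul_right, ← hKs, hKw, real_inner_smul_left]
    linear_combination ⟪w, R v⟫ * hs
  rw [this, hwR] at hww
  norm_num at hww

lemma sec_eq_of_apply_eq {v : ⋀[ℝ]^2 V} (hv : v ∈ unitDecomposable V) {x y : ℝ}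
    (hRv : R v = x • v + y • volumeOperator o v) : sec R v = x := by
  obtain ⟨hKv, hnorm⟩ := (mem_unitDecomposable_iff o v).1 hv
  rw [sec, hRv, inner_add_right, real_inner_smul_right, real_inner_smul_right,
    real_inner_self_eq_norm_sq, hnorm, real_inner_comm, hKv]
  ring

/-- The critical points of the sectional curvature are the points of the Grassmannian that solve
the Lagrange multiplier equation; the critical value is the first multiplier. -/
lemma isCriticalPoint_iff (o : Orientation ℝ V (Fin 4)) (hR : R.IsSymmetric) {v : ⋀[ℝ]^2 V} :
    IsCriticalPoint R v ↔ v ∈ unitDecomposable V ∧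
      ∃ y : ℝ, R v = sec R v • v + y • volumeOperator o v := by
  constructor
  · intro hv
    refine ⟨hv.1, ?_⟩
    obtain ⟨a, ha⟩ := hv.exists_smul_eq (o := o) hR (s := 1) (by norm_num)
    obtain ⟨b, hb⟩ := hv.exists_smul_eq (o := o) hR (s := -1) (by norm_num)
    have hRv : R v = ((a + b) / 2) • v + ((a - b) / 2) • volumeOperator o v := by
      have h2 : R v = (1 / 2 : ℝ) • ((R v + (1 : ℝ) • volumeOperator o (R v)) +
          (R v + (-1 : ℝ) • volumeOperator o (R v))) := by module
      rw [h2, ha, hb]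
      module
    exact ⟨(a - b) / 2, by rw [sec_eq_of_apply_eq hv.1 hRv]; exact hRv⟩
  · rintro ⟨hv, y, hRv⟩
    refine ⟨hv, fun γ hγ hmem h0 => ?_⟩
    have hd : HasDerivAt γ (deriv γ 0) 0 :=
      (hγ.differentiable (by simp)).differentiableAt.hasDerivAt
    have h1 := hasDerivAt_sec_comp hR hd
    have h2 := hasDerivAt_sec_comp (R := LinearMap.id) LinearMap.IsSymmetric.id hd
    have h3 := hasDerivAt_sec_comp (isSymmetric_volumeOperator o) hd
    have e2 : (fun s => sec LinearMap.id (γ s)) = fun _ => (1 : ℝ) := funext fun s => by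
      rw [sec, LinearMap.id_apply, real_inner_self_eq_norm_sq, (hmem s).2, one_pow]
    have e3 : (fun s => sec (volumeOperator o) (γ s)) = fun _ => (0 : ℝ) := funext fun s => by
      rw [sec, real_inner_comm, ((mem_unitDecomposable_iff o _).1 (hmem s)).1]
    rw [e2] at h2
    rw [e3] at h3
    have u2 := h2.unique (hasDerivAt_const 0 1)
    have u3 := h3.unique (hasDerivAt_const 0 0)
    convert h1 using 1
    rw [h0] at u2 u3 ⊢
    rw [hRv, inner_add_right, inner_smul_right, inner_smul_right]
    rw [LinearMap.id_apply] at u2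
    linear_combination -sec R v * u2 - y * u3

lemma isCompact_unitDecomposable (o : Orientation ℝ V (Fin 4)) :
    IsCompact (unitDecomposable V) := by
  have : unitDecomposable V = Metric.sphere 0 1 ∩ {v | ⟪volumeOperator o v, v⟫ = 0} := by
    ext v
    rw [mem_unitDecomposable_iff o]
    simp [and_comm]
  rw [this]
  refine (isCompact_sphere _ _).inter_right (isClosed_eq ?_ continuous_const)
  exact (volumeOperator o).continuous_of_finiteDimensional.inner continuous_id

/-- The minimum of the sectional curvature is a critical value. -/
lemma exists_mem_criticalValues_forall_le (o : Orientation ℝ V (Fin 4)) (hR : R.IsSymmetric) :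
    ∃ c ∈ criticalValues R, ∀ v ∈ unitDecomposable V, c ≤ sec R v := by
  have hne : (unitDecomposable V).Nonempty := by
    refine ⟨wedgeBasis (orientedBasis o) 0, ⟨_, _, wedgeBasis_apply _ 0⟩, ?_⟩
    exact (wedgeBasis (orientedBasis o)).norm_eq_one 0
  have hcont : Continuous (sec R) := continuous_id.inner R.continuous_of_finiteDimensional
  obtain ⟨v, hv, hmin⟩ := (isCompact_unitDecomposable o).exists_isMinOn hne hcont.continuousOn
  refine ⟨sec R v, ⟨v, ⟨hv, fun γ hγ hmem h0 => ?_⟩, rfl⟩, fun w hw => hmin hw⟩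
  have hd := hasDerivAt_sec_comp hR
    (hγ.differentiable (by simp)).differentiableAt.hasDerivAt (t := 0)
  have hloc : IsLocalMin (fun s => sec R (γ s)) 0 :=
    Filter.Eventually.of_forall fun s => by
      have hs : sec R v ≤ sec R (γ s) := hmin (hmem s)
      simpa only [h0] using hs
  rwa [hloc.hasDerivAt_eq_zero hd] at hd

lemma criticalValues_subset (o : Orientation ℝ V (Fin 4)) (hR : R.IsSymmetric) :
    criticalValues R ⊆ {x : ℝ | (discPoly o R).IsRoot x} := by
  rintro _ ⟨v, hv, rfl⟩
  obtain ⟨hmem, y, hRv⟩ := (isCriticalPoint_iff o hR).1 hv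
  obtain ⟨hKv, hnorm⟩ := (mem_unitDecomposable_iff o v).1 hmem
  have hv0 : v ≠ 0 := by rintro rfl; simp at hnorm
  have hmult := two_le_rootMultiplicity hR hv0 hKv hRv
  open Polynomial in
  have hdvd : (X - C y) ^ 2 ∣ (detPoly o R).map (evalRingHom (sec R v)) := by
    rw [map_evalRingHom_detPoly]
    exact ((pow_dvd_pow _ hmult).trans (pow_rootMultiplicity_dvd _ _)).mul_left _
  rw [Set.mem_ofPred_eq, discPoly, Polynomial.isRoot_discr_iff (isUnit_leadingCoeff_detPoly o R)
    (by rw [(natDegree_detPoly_and_leadingCoeff o R).1]; norm_num)]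
  exact fun hc => Polynomial.not_isUnit_X_sub_C y
    (hc.isUnit_of_dvd' ((dvd_pow_self _ two_ne_zero).trans hdvd)
      (by simpa using Polynomial.pow_sub_one_dvd_derivative_of_pow_dvd hdvd))

/-- Simple roots of `q` are critical values. -/
lemma mem_criticalValues_of_isRoot (hR : R.IsSymmetric) {x : ℝ} (hx : (discPoly o R).IsRoot x)
    (hsimple : ¬ (Polynomial.X - Polynomial.C x) ^ 2 ∣ discPoly o R) : x ∈ criticalValues R := by
  have hunit := isUnit_leadingCoeff_detPoly o R
  have hdeg : 2 ≤ (detPoly o R).natDegree := by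
    rw [(natDegree_detPoly_and_leadingCoeff o R).1]; norm_num
  obtain ⟨y, hy, hy'⟩ := Polynomial.exists_real_multiple_root hunit hdeg hx hsimple
  have hmult : 2 ≤ (volumeOperator o ∘ₗ (R - x • LinearMap.id)).charpoly.rootMultiplicity y := by
    have h0 := LinearMap.charpoly_monic (volumeOperator o ∘ₗ (R - x • LinearMap.id))
    rw [← Polynomial.eval₂_evalRingHom, ← Polynomial.eval_map] at hy hy'
    rw [← Polynomial.derivative_map] at hy'
    rw [map_evalRingHom_detPoly] at hy hy'
    rw [Polynomial.derivative_C_mul, Polynomial.eval_mul, Polynomial.eval_C] at hy'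
    rw [Polynomial.eval_mul, Polynomial.eval_C] at hy
    have hd := det_volumeOperator_ne_zero o
    exact (Polynomial.one_lt_rootMultiplicity_iff_isRoot h0.ne_zero).2
      ⟨(mul_eq_zero.1 hy).resolve_left hd, (mul_eq_zero.1 hy').resolve_left hd⟩
  have hlt : (R - y • volumeOperator o).charpoly.rootMultiplicity x < 2 := by
    by_contra! hge
    refine hsimple (Polynomial.sq_dvd_discr_of_singular hunit hdeg (y := y) ?_ hy')
    rw [eval_C_detPoly]
    exact (pow_dvd_pow _ hge).trans (Polynomial.pow_rootMultiplicity_dvd _ _)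
  obtain ⟨v, hv0, hKv, hRv⟩ := exists_isotropic hR hmult hlt
  have hn : ‖v‖ ≠ 0 := norm_ne_zero_iff.2 hv0
  set w := ‖v‖⁻¹ • v with hw
  have hwnorm : ‖w‖ = 1 := by rw [hw, norm_smul, norm_inv, norm_norm, inv_mul_cancel₀ hn]
  have hKw : ⟪volumeOperator o w, w⟫ = 0 := by
    rw [hw, map_smul, real_inner_smul_left, inner_smul_right, hKv, mul_zero, mul_zero]
  have hRw : R w = x • w + y • volumeOperator o w := by
    rw [hw, map_smul, hRv, map_smul, smul_add, smul_comm _ x, smul_comm _ y]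
  have hw' := (mem_unitDecomposable_iff o w).2 ⟨hKw, hwnorm⟩
  have hsec : sec R w = x := sec_eq_of_apply_eq hw' hRw
  exact ⟨w, (isCriticalPoint_iff o hR).2 ⟨hw', y, by rw [hsec]; exact hRw⟩, hsec⟩

end Curv4

/-! ### Roots of `q` and critical values -/

theorem theorem1p1 {V : Type*} [NormedAddCommGroup V] [InnerProductSpace ℝ V]
    [FiniteDimensional ℝ V] [Fact (Module.finrank ℝ V = 4)] (o : Orientation ℝ V (Fin 4))
    (R : ⋀[ℝ]^2 V →ₗ[ℝ] ⋀[ℝ]^2 V) (hR : R.IsSymmetric) :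
    Curv4.criticalValues R ⊆ {x : ℝ | (Curv4.discPoly o R).IsRoot x} ∧
    ((∀ x : ℝ, (Curv4.discPoly o R).IsRoot x → 0 < x) → Curv4.SectionallyPositive R) ∧
    ((∀ x : ℝ, (Curv4.discPoly o R).IsRoot x → 0 ≤ x) → Curv4.SectionallyNonneg R) ∧
    (Curv4.discPoly o R ≠ 0 → (Curv4.discPoly o R).discr ≠ 0 →
      Curv4.criticalValues R = {x : ℝ | (Curv4.discPoly o R).IsRoot x} ∧
      (Curv4.SectionallyPositive R ↔ ∀ x : ℝ, (Curv4.discPoly o R).IsRoot x → 0 < x) ∧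
      (Curv4.SectionallyNonneg R ↔ ∀ x : ℝ, (Curv4.discPoly o R).IsRoot x → 0 ≤ x)) := by
  have hsub := Curv4.criticalValues_subset o hR
  obtain ⟨c, hc, hmin⟩ := Curv4.exists_mem_criticalValues_forall_le o hR
  have hpos : (∀ x : ℝ, (Curv4.discPoly o R).IsRoot x → 0 < x) → Curv4.SectionallyPositive R :=
    fun h v hv => (h c (hsub hc)).trans_le (hmin v hv)
  have hnonneg : (∀ x : ℝ, (Curv4.discPoly o R).IsRoot x → 0 ≤ x) → Curv4.SectionallyNonneg R :=
    fun h v hv => (h c (hsub hc)).trans (hmin v hv)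
  refine ⟨hsub, hpos, hnonneg, fun hq hdisc => ?_⟩
  have hmem : ∀ x : ℝ, (Curv4.discPoly o R).IsRoot x → x ∈ Curv4.criticalValues R := fun x hx =>
    Curv4.mem_criticalValues_of_isRoot hR hx fun h =>
      hdisc (Polynomial.discr_eq_zero_of_sq_dvd hq h)
  refine ⟨hsub.antisymm hmem, ⟨fun h x hx => ?_, hpos⟩, ⟨fun h x hx => ?_, hnonneg⟩⟩
  · obtain ⟨v, hv, rfl⟩ := hmem x hx
    exact h v hv.1
  · obtain ⟨v, hv, rfl⟩ := hmem x hx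
    exact h v hv.1
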